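/- A \emph{problem} $\mathsf P$ assigns to each of its instances $x$ a set of solutions. We say that $\mathsf P$ is Weihrauch reducible to $\mathsf Q$, $\mathsf P\leq_{\mathrm W}\mathsf Q$, if there are Turing functionals $H$ and $K$ such that, for every $\mathsf P$-instance $x$, $H(x)$ is a $\mathsf Q$-instance, and for every $\mathsf Q$-solution $y'$ to $H(x)$, $K(x\oplus y')$ is a $\mathsf P$-solution to $x$ (instances and solutions being coded as elements of $\mathbb N^{\mathbb N}$). The problem $\mathsf{ECT}$ (Eventually Constant Tail) has as instances the pairs $(n,f)$ with $n\in\mathbb N$ and $f:\mathbb N\to\{0,\dots,n-1\}$; a solution to $(n,f)$ is any $b\in\mathbb N$ such that for every $x>b$ there is $y>x$ with $f(x)=f(y)$. For a linear order $X$, let $X^\omega$ be the set of finite sequences $\langle(b_0,a_0),\dots,(b_m,a_m)\rangle$ with $b_i\in\mathbb N$, $b_0>b_1>\dots>b_m$, and each $a_i\in X$ different from the least element of $X$ (if there is one), together with the empty sequence, ordered lexicographically: a proper extension of a sequence is larger, and otherwise the first pair at which two sequences differ decides, pairs being compared first by $b$ and then by $a$ in $X$. The problem $\mathsf{WOP}(X\mapsto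 X^\omega)$ has as instances the pairs consisting of a linear order $X$ with $X\subseteq\mathbb N$ (coded by the characteristic function of $\leq_X$) and an infinite strictly decreasing sequence $(\sigma_i)_{i\in\mathbb N}$ in $X^\omega$; a solution is an infinite strictly decreasing sequence $(x_i)_{i\in\mathbb N}$ in $X$ that is contained in $\sigma$, i.e. there are $t_0\leq t_1\leq\dots$ in $\mathbb N$ such that for every $i$ the element $x_i$ is one of the coefficients $a_j$ occurring in $\sigma_{t_i}$. Then $$\mathsf{ECT}\leq_{\mathrm W}\mathsf{WOP}(X\mapsto X^\omega).$$ -/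

import Mathlib

/-! ## Turing functionals -/

/-- Programs of an oracle machine on `ℕ`: the schemes of partial recursion together with a query
to the oracle.  (The same schemes as in `Nat.RecursiveIn`, as a datatype, so that one program can
be run on every oracle.) -/
inductive TuringCode : Type
  | zero : TuringCode
  | succ : TuringCode
  | left : TuringCode
  | right : TuringCode
  | oracle : TuringCode
  | pair : TuringCode → TuringCode → TuringCode
  | comp : TuringCode → TuringCode → TuringCode
  | prec : TuringCode → TuringCode → TuringCode
  | rfind : TuringCode → TuringCode

/-- `c.eval p n` is the result (if any) of running the program `c` with oracle `p` on input `n`. -/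
def TuringCode.eval : TuringCode → (ℕ → ℕ) → ℕ →. ℕ
  | .zero, _ => fun _ => Part.some 0
  | .succ, _ => fun n => Part.some (n + 1)
  | .left, _ => fun n => Part.some n.unpair.1
  | .right, _ => fun n => Part.some n.unpair.2
  | .oracle, p => fun n => Part.some (p n)
  | .pair f g, p => fun n => Nat.pair <$> f.eval p n <*> g.eval p n
  | .comp f g, p => fun n => g.eval p n >>= f.eval p
  | .prec f g, p => fun m =>
      Nat.rec (f.eval p m.unpair.1)
        (fun y IH => IH >>= fun i => g.eval p (Nat.pair m.unpair.1 (Nat.pair y i))) m.unpair.2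
  | .rfind f, p => fun a => Nat.rfind fun n => (fun m => decide (m = 0)) <$> f.eval p (Nat.pair a n)

/-- The Turing functional given by `c` is defined at the point `p` of Baire space, with
value `q`. -/
def TuringCode.MapsTo (c : TuringCode) (p q : ℕ → ℕ) : Prop :=
  ∀ n, c.eval p n = Part.some (q n)

/-- The join `p ⊕ q`: `p` on the even numbers and `q` on the odd ones. -/
def joinSeq (p q : ℕ → ℕ) (n : ℕ) : ℕ := if n % 2 = 0 then p (n / 2) else q (n / 2)

theorem joinSeq_injective {p q p' q' : ℕ → ℕ} (h : joinSeq p q = joinSeq p' q') :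
    p = p' ∧ q = q' := by
  constructor
  · funext n
    simpa [joinSeq] using congrFun h (2 * n)
  · funext n
    have h1 : (2 * n + 1) % 2 = 1 := by omega
    have h2 : (2 * n + 1) / 2 = n := by omega
    simpa [joinSeq, h1, h2] using congrFun h (2 * n + 1)

/-! ## Problems and Weihrauch reducibility -/

/-- A class of objects each of which has a (unique) name in Baire space. -/
class Named (A : Type) where
  name : A → ℕ → ℕ
  name_injective : Function.Injective name

instance : Named ℕ where
  name b := fun _ => b
  name_injective _ _ h := congrFun h 0

instance : Named (ℕ → ℕ) where
  name p := p
  name_injective _ _ h := h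

instance {A B : Type} [Named A] [Named B] : Named (A × B) where
  name x := joinSeq (Named.name x.1) (Named.name x.2)
  name_injective _ _ h :=
    Prod.ext (Named.name_injective (joinSeq_injective h).1)
      (Named.name_injective (joinSeq_injective h).2)

/-- An instance-solution problem: a partial function from `A` to the subsets of `B`, with
domain `inst`. -/
structure Problem (A B : Type) where
  inst : Set A
  sol : A → Set B

/-- `P ≤_W Q`: there are Turing functionals `H` and `K` such that `H` maps every `P`-instance `x` to
a `Q`-instance `x'`, and `K` maps `x ⊕ y'` to a `P`-solution to `x`, for every `Q`-solution `y'`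
to `x'`. -/
def WeihrauchReducible {A B A' B' : Type} [Named A] [Named B] [Named A'] [Named B']
    (P : Problem A B) (Q : Problem A' B') : Prop :=
  ∃ H K : TuringCode, ∀ x ∈ P.inst, ∃ x' ∈ Q.inst,
    H.MapsTo (Named.name x) (Named.name x') ∧
      ∀ y' ∈ Q.sol x', ∃ y ∈ P.sol x,
        K.MapsTo (joinSeq (Named.name x) (Named.name y')) (Named.name y)

infix:50 " ≤_W " => WeihrauchReducible

/-! ## The eventually constant tail principle -/

/-- Instances are the pairs `(n, f)` such that `f` is a colouring of the natural numbers with colours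
in `{0, …, n - 1}`; solutions are the `b` after which every colour that occurs occurs again. -/
def ECT : Problem (ℕ × (ℕ → ℕ)) ℕ where
  inst := {x | ∀ k, x.2 k < x.1}
  sol x := {b | ∀ k > b, ∃ l > k, x.2 k = x.2 l}

/-! ## The operator `X ↦ X^ω` and its well-ordering principle -/

/-- The elements of `X^ω`: finite sequences of pairs `(b, a)` with strictly decreasing exponents
`b` and with coefficients `a` in `X` other than the least element of `X` (if there is one).
The order is inherited from `List (ℕ ×ₗ X)`, hence lexicographic: a proper extension
is larger, and otherwise the first pairs that differ decide, first by `b` and then by `a`.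
The empty sequence is the zero of `X^ω`; being least, it is not a term of any infinite decreasing
sequence. -/
def OmegaPow (X : Type) [LinearOrder X] : Type :=
  {s : List (ℕ ×ₗ X) // s.Pairwise (fun u v => (ofLex v).1 < (ofLex u).1) ∧
    ∀ u ∈ s, ¬ IsBot (ofLex u).2}

noncomputable instance (X : Type) [LinearOrder X] : LinearOrder (OmegaPow X) :=
  inferInstanceAs (LinearOrder {s : List (ℕ ×ₗ X) //
    s.Pairwise (fun u v => (ofLex v).1 < (ofLex u).1) ∧ ∀ u ∈ s, ¬ IsBot (ofLex u).2})

/-- `a` is one of the sub-terms of `s` from `X`. -/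
def OmegaPow.IsSubterm {X : Type} [LinearOrder X] (a : X) (s : OmegaPow X) : Prop :=
  ∃ b : ℕ, toLex (b, a) ∈ s.1

/-- The sequence `τ` in `X` is contained in the sequence `σ` in `X^ω`: it consists of sub-terms of
the elements of `σ`, in the same relative order. -/
def IsContainedIn {X : Type} [LinearOrder X] (τ : ℕ → X) (σ : ℕ → OmegaPow X) : Prop :=
  ∃ t : ℕ → ℕ, Monotone t ∧ ∀ i, OmegaPow.IsSubterm (τ i) (σ (t i))

/-- A linear order whose elements are natural numbers, given by its order relation as a set
of pairs; the elements are the `a` with `a ≤_X a`. -/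
structure CodedLinearOrder where
  le : ℕ → ℕ → Prop
  refl_left : ∀ {a b}, le a b → le a a
  refl_right : ∀ {a b}, le a b → le b b
  trans : ∀ {a b c}, le a b → le b c → le a c
  antisymm : ∀ {a b}, le a b → le b a → a = b
  total : ∀ {a b}, le a a → le b b → le a b ∨ le b a

/-- The elements of a coded linear order. -/
@[ext] structure CodedLinearOrder.Elem (X : CodedLinearOrder) where
  val : ℕ
  mem : X.le val val

open Classical in
noncomputable instance (X : CodedLinearOrder) : LinearOrder X.Elem where
  le a b := X.le a.val b.val
  le_refl a := a.mem
  le_trans _ _ _ := X.trans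
  le_antisymm _ _ h h' := CodedLinearOrder.Elem.ext (X.antisymm h h')
  le_total a b := X.total a.mem b.mem
  toDecidableLE := inferInstance

open Classical in
/-- The name of a coded linear order is the characteristic function of its order relation. -/
noncomputable instance : Named CodedLinearOrder where
  name X := fun n => if X.le n.unpair.1 n.unpair.2 then 1 else 0
  name_injective := by
    intro X Y h
    have hle : X.le = Y.le := by
      funext a b
      have := congrFun h (Nat.pair a b)
      simp only [Nat.unpair_pair] at this
      by_cases hX : X.le a b <;> by_cases hY : Y.le a b <;> simp_all
    cases X
    cases Y
    cases hle
    rfl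

/-- The number that codes the finite sequence `⟨(b₀, a₀), …⟩` of pairs of natural numbers. -/
def CodedLinearOrder.encodeTerm (X : CodedLinearOrder) (s : OmegaPow X.Elem) : ℕ :=
  Encodable.encode (s.1.map fun u => ((ofLex u).1, (ofLex u).2.val))

theorem CodedLinearOrder.encodeTerm_injective (X : CodedLinearOrder) :
    Function.Injective X.encodeTerm := by
  intro s s' h
  apply Subtype.ext
  refine List.map_injective_iff.2 ?_ (Encodable.encode_injective h)
  intro u v huv
  have h1 := congrArg Prod.fst huv
  have h2 := congrArg Prod.snd huv
  exact ofLex.injective (Prod.ext h1 (CodedLinearOrder.Elem.ext h2))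

/-- A linear order `X` together with a sequence in `X^ω`. -/
def OmegaPowSeq : Type := Σ X : CodedLinearOrder, ℕ → OmegaPow X.Elem

/-- Such a pair is named by the join of the name of `X` and the sequence of the codes of the
terms. -/
noncomputable instance : Named OmegaPowSeq where
  name x := joinSeq (Named.name x.1) (fun i => x.1.encodeTerm (x.2 i))
  name_injective := by
    rintro ⟨X, σ⟩ ⟨Y, τ⟩ h
    obtain ⟨h1, h2⟩ := joinSeq_injective h
    obtain rfl : X = Y := Named.name_injective h1
    have : σ = τ := funext fun i => X.encodeTerm_injective (congrFun h2 i)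
    rw [this]

/-- The problem `WOP(X ↦ X^ω)`: an instance is a linear order `X` with an infinite decreasing sequence
`σ` in `X^ω`; a solution is an infinite decreasing sequence in `X` that is contained in `σ`. -/
def WOPOmega : Problem OmegaPowSeq (ℕ → ℕ) where
  inst := {x | StrictAnti x.2}
  sol x := {τ | ∃ y : ℕ → x.1.Elem, StrictAnti y ∧ IsContainedIn y x.2 ∧ ∀ i, τ i = (y i).val}

/-! ## Primitive recursion relative to an oracle -/

/-! The rank of a stage `t` counts the colours seen since the previous occurrence of the colour of
`t`. The key lemma `exists_recurrence` says that `b` is a solution as soon as the maximal rank `r`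
from `b` on is attained infinitely often. Late ranks show that at least `r` colours are recurrent;
if a colour disappeared after some stage from `b` on, one later rank would count it along with all
recurrent colours and so exceed `r`.

Let `X` consist of the pairs `(b, t)` where `t` has maximal rank within `[b, t]`, ordered by `b` and
then by reversed `t`. In a descending sequence in `X` the `b` stabilise and the `t` tend to
infinity, so the limit of the `b` is a solution. So is every larger number, in particular the first
component of the first entry, which is all that `K` reads off.

The descending sequence in `X^ω` has, in its term `k`, a coefficient for each exponent `j ≤ n`: its
`t` is the last stage up to `k` of rank at least `j`, its `b` the successor of the last one of rank
at least `j + 1`. A new stage of rank `r` leaves the coefficients above `r` alone and lowers the one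
at `r` (`strictAnti_recordTerm`). -/

/-- `F p n` is computed by one program with oracle `p`, uniformly in `p`. -/
def IsTuringFunctional (F : (ℕ → ℕ) → ℕ → ℕ) : Prop :=
  ∃ c : TuringCode, ∀ p, c.MapsTo p (F p)

namespace IsTuringFunctional

theorem oracle : IsTuringFunctional fun p => p :=
  ⟨.oracle, fun _ _ => rfl⟩

theorem pair {F G : (ℕ → ℕ) → ℕ → ℕ} (hF : IsTuringFunctional F) (hG : IsTuringFunctional G) :
    IsTuringFunctional fun p n => Nat.pair (F p n) (G p n) := by
  obtain ⟨c, hc⟩ := hF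
  obtain ⟨d, hd⟩ := hG
  refine ⟨.pair c d, fun p n => ?_⟩
  simp [TuringCode.eval, hc p n, hd p n, Seq.seq]

theorem comp {F G : (ℕ → ℕ) → ℕ → ℕ} (hF : IsTuringFunctional F) (hG : IsTuringFunctional G) :
    IsTuringFunctional fun p n => F p (G p n) := by
  obtain ⟨c, hc⟩ := hF
  obtain ⟨d, hd⟩ := hG
  refine ⟨.comp c d, fun p n => ?_⟩
  simp only [TuringCode.eval, hd p n]
  exact (Part.bind_some _ _).trans (hc p _)

theorem prec {F G : (ℕ → ℕ) → ℕ → ℕ} (hF : IsTuringFunctional F) (hG : IsTuringFunctional G) :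
    IsTuringFunctional fun p m => Nat.rec (F p m.unpair.1)
      (fun y i => G p (Nat.pair m.unpair.1 (Nat.pair y i))) m.unpair.2 := by
  obtain ⟨c, hc⟩ := hF
  obtain ⟨d, hd⟩ := hG
  refine ⟨.prec c d, fun p m => ?_⟩
  simp only [TuringCode.eval]
  induction m.unpair.2 with
  | zero => exact hc p _
  | succ k ih =>
    simp only [ih]
    exact (Part.bind_some _ _).trans (hd p _)

theorem of_primrec {g : ℕ → ℕ} (hg : Nat.Primrec g) : IsTuringFunctional fun _ => g := by
  induction hg with
  | zero => exact ⟨.zero, fun _ _ => rfl⟩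
  | succ => exact ⟨.succ, fun _ _ => rfl⟩
  | left => exact ⟨.left, fun _ _ => rfl⟩
  | right => exact ⟨.right, fun _ _ => rfl⟩
  | pair _ _ hf hg => exact hf.pair hg
  | comp _ _ hf hg => exact hf.comp hg
  | prec _ _ hf hg => exact hf.prec hg

/-- The initial segments of the oracle are uniformly computable. -/
theorem initialSegment :
    IsTuringFunctional fun p n => Encodable.encode ((List.range n).map p).reverse := by
  -- The code of `a :: l` is the successor of the pair of the codes. The recursion puts the newest
  -- oracle value in front, whence the reversed list.
  have step : IsTuringFunctional fun p m =>
      Nat.succ (Nat.pair (p m.unpair.2.unpair.1) m.unpair.2.unpair.2) :=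
    (of_primrec .succ).comp
      ((oracle.comp (of_primrec (.comp .left .right))).pair (of_primrec (.comp .right .right)))
  have h := ((of_primrec .zero).prec step).comp
    (of_primrec (Nat.Primrec.pair .zero (Primrec.nat_iff.1 Primrec.id)))
  convert h using 3 with p n
  simp only [Nat.unpair_pair, id]
  induction n with
  | zero => rfl
  | succ n ih => simp [List.range_succ, ← ih]

/-- A function that is primitive recursive in a primitively recursively bounded initial segment
of the oracle is uniformly computable. -/
theorem of_primrec_initialSegment {F : List ℕ → ℕ → ℕ} {u : ℕ → ℕ} (hF : Primrec₂ F)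
    (hu : Primrec u) : IsTuringFunctional fun p n => F ((List.range (u n)).map p) n := by
  have hg : Primrec fun v : ℕ => F ((Encodable.decode v.unpair.2).getD []).reverse v.unpair.1 :=
    hF.comp (Primrec.list_reverse.comp (Primrec.option_getD.comp
        (Primrec.decode.comp (Primrec.snd.comp Primrec.unpair)) (Primrec.const [])))
      (Primrec.fst.comp Primrec.unpair)
  have h := (of_primrec (Primrec.nat_iff.1 hg)).comp
    ((of_primrec (Primrec.nat_iff.1 Primrec.id)).pair
      (initialSegment.comp (of_primrec (Primrec.nat_iff.1 hu))))
  convert h using 3 with p n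
  simp

end IsTuringFunctional

/-! ## Ranks of a colouring -/

/-- The number of colours below `n` that occur since the previous occurrence of the colour of `t`;
it is `n` if there is no previous occurrence. -/
def recurrenceRank (n : ℕ) (f : ℕ → ℕ) (t : ℕ) : ℕ :=
  ((List.range n).filter fun c => ∀ s < t, f s = f t → ∃ u < t, s ≤ u ∧ f u = c).length

section Rank

variable {n : ℕ} {f g : ℕ → ℕ}

theorem recurrenceRank_eq_card (t : ℕ) : recurrenceRank n f t =
    ((Finset.range n).filter fun c => ∀ s < t, f s = f t → ∃ u < t, s ≤ u ∧ f u = c).card :=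
  rfl

theorem recurrenceRank_le (t : ℕ) : recurrenceRank n f t ≤ n :=
  (List.length_filter_le _ _).trans_eq List.length_range

theorem recurrenceRank_congr {t : ℕ} (h : ∀ i ≤ t, f i = g i) :
    recurrenceRank n f t = recurrenceRank n g t := by
  unfold recurrenceRank
  congr 2
  funext c
  congr 1
  refine propext (forall₂_congr fun s hs => ?_)
  rw [h s hs.le, h t le_rfl]
  refine imp_congr_right fun _ => exists_congr fun u => and_congr_right fun hu => ?_
  rw [h u hu.le]

/-- If from `b` on no rank exceeds `r` while infinitely many ranks reach `r`, then every colour that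
occurs from `b` on occurs again. -/
theorem exists_recurrence (hf : ∀ k, f k < n) {b r : ℕ}
    (hle : ∀ i ≥ b, recurrenceRank n f i ≤ r) (hge : ∀ N, ∃ t ≥ N, r ≤ recurrenceRank n f t)
    {k : ℕ} (hk : b ≤ k) : ∃ l > k, f k = f l := by
  classical
  by_contra! hlast
  -- `I` is the set of colours that occur infinitely often.
  let I := (Finset.range n).filter fun c => ∀ N, ∃ t ≥ N, f t = c
  have hI : ∀ c, c ∈ I ↔ c < n ∧ ∀ N, ∃ t ≥ N, f t = c := by simp [I]
  obtain ⟨T, hkT, hT⟩ : ∃ T > k, ∀ t ≥ T, f t ∈ I := by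
    have h : ∀ᶠ T in Filter.atTop, ∀ c ∈ Finset.range n, c ∉ I → f T ≠ c := by
      refine (Filter.eventually_all_finset _).2 fun c hc => ?_
      by_cases hcI : c ∈ I
      · exact Filter.Eventually.of_forall fun _ h => absurd hcI h
      · obtain ⟨N, hN⟩ : ∃ N, ∀ t ≥ N, f t ≠ c := by
          by_contra! h
          exact hcI ((hI c).2 ⟨Finset.mem_range.1 hc, h⟩)
        exact Filter.eventually_atTop.2 ⟨N, fun t ht _ => hN t ht⟩
    obtain ⟨T, hT⟩ := Filter.eventually_atTop.1 h
    refine ⟨max T (k + 1), by omega, fun t ht => ?_⟩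
    by_contra hc
    exact hT t (by omega) (f t) (Finset.mem_range.2 (hf t)) hc rfl
  have hkI : f k ∉ I := fun h => by
    obtain ⟨t, ht, he⟩ := ((hI _).1 h).2 (k + 1)
    exact hlast t ht he.symm
  -- Far enough out, the previous occurrence of any colour lies beyond `T`, so only colours in `I`
  -- are counted.
  have hrI : r ≤ I.card := by
    have h : ∀ᶠ T' in Filter.atTop, ∀ c ∈ I, ∃ s ≥ T, s < T' ∧ f s = c := by
      refine (Filter.eventually_all_finset _).2 fun c hc => ?_
      obtain ⟨s, hs, he⟩ := ((hI c).1 hc).2 T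
      exact Filter.eventually_atTop.2 ⟨s + 1, fun t ht => ⟨s, hs, by omega, he⟩⟩
    obtain ⟨T', hT'⟩ := Filter.eventually_atTop.1 h
    obtain ⟨t, ht, hrt⟩ := hge (max T T')
    refine hrt.trans ?_
    rw [recurrenceRank_eq_card]
    refine Finset.card_le_card fun c hc => ?_
    obtain ⟨s, hs, hst, he⟩ := hT' t (by omega) (f t) (hT t (by omega))
    obtain ⟨u, -, hu, rfl⟩ := (Finset.mem_filter.1 hc).2 s hst he
    exact hT u (by omega)
  have hex : ∀ c ∈ I, ∃ t > k, f t = c := fun c hc => ((hI c).1 hc).2 (k + 1)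
  choose! m hmk hmc hmin using fun c hc =>
    (⟨Nat.find (hex c hc), (Nat.find_spec (hex c hc)).1, (Nat.find_spec (hex c hc)).2,
      fun s hs he => Nat.find_min' (hex c hc) ⟨hs, he⟩⟩ :
      ∃ t, t > k ∧ f t = c ∧ ∀ s > k, f s = c → t ≤ s)
  -- `c` is the recurrent colour whose first occurrence after `k` comes last. Its previous
  -- occurrence, if any, is at or before `k`, so its rank at `m c` counts `f k` and all of `I`.
  obtain ⟨c, hc, hmax⟩ := Finset.exists_max_image I m ⟨f T, hT T le_rfl⟩
  have hcard : I.card + 1 ≤ recurrenceRank n f (m c) := by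
    rw [← Finset.card_insert_of_notMem hkI, recurrenceRank_eq_card]
    refine Finset.card_le_card fun d hd => Finset.mem_filter.2 ?_
    have hs' : ∀ s < m c, f s = f (m c) → s ≤ k := fun s hs he => by
      by_contra! h
      have := hmin c hc s h (he.trans (hmc c hc))
      omega
    have hkm := hmk c hc
    obtain rfl | hd := Finset.mem_insert.1 hd
    · exact ⟨Finset.mem_range.2 (hf k), fun s hs he => ⟨k, hkm, hs' s hs he, rfl⟩⟩
    · refine ⟨Finset.mem_range.2 ((hI d).1 hd).1, fun s hs he => ?_⟩
      obtain rfl | hdc := eq_or_ne d c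
      · exact ⟨s, hs, le_rfl, he.trans (hmc d hc)⟩
      · have hne : m d ≠ m c := fun h => hdc (by rw [← hmc d hd, h, hmc c hc])
        exact ⟨m d, lt_of_le_of_ne (hmax d hd) hne, (hs' s hs he).trans (hmk d hd).le, hmc d hd⟩
  have := hle (m c) (hk.trans (hmk c hc).le)
  omega

end Rank

/-! ## The linear order of a colouring -/

/-- `(b, t)` belongs to the linear order of the colouring `f` if `t` has maximal rank
from `b` on, up to `t`; the pair `(0, 0)` is added as a least element. -/
def IsRecord (n : ℕ) (f : ℕ → ℕ) (b t : ℕ) : Prop :=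
  b = 0 ∧ t = 0 ∨
    1 ≤ b ∧ b ≤ t + 1 ∧ ∀ i < t, b ≤ i → recurrenceRank n f i ≤ recurrenceRank n f t

theorem isRecord_congr {n : ℕ} {f g : ℕ → ℕ} {b t : ℕ} (h : ∀ i ≤ t, f i = g i) :
    IsRecord n f b t ↔ IsRecord n g b t := by
  have h' : ∀ i ≤ t, recurrenceRank n f i = recurrenceRank n g i := fun i hi =>
    recurrenceRank_congr fun j hj => h j (hj.trans hi)
  unfold IsRecord
  refine or_congr_right (and_congr_right fun _ => and_congr_right fun _ =>
    forall₂_congr fun i hi => ?_)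
  rw [h' i hi.le, h' t le_rfl]

/-- Ranks are bounded by `n`, so from `b` on some stage attains their maximum; every later record
attains it too. The adjoined pair `(0, 0)` is ruled out by `t > N`. -/
theorem exists_recurrence_of_isRecord {n : ℕ} {f : ℕ → ℕ} (hf : ∀ k, f k < n) {b : ℕ}
    (h : ∀ N, ∃ t > N, IsRecord n f b t) {k : ℕ} (hk : b ≤ k) : ∃ l > k, f k = f l := by
  obtain ⟨i, hi, hmax⟩ : ∃ i ≥ b, ∀ j ≥ b, recurrenceRank n f j ≤ recurrenceRank n f i := by
    classical
    have hb : ∃ i ≥ b, recurrenceRank n f i = recurrenceRank n f b := ⟨b, le_rfl, rfl⟩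
    obtain ⟨i, hi, he⟩ := Nat.findGreatest_spec
      (P := fun r => ∃ i ≥ b, recurrenceRank n f i = r) (recurrenceRank_le b) hb
    exact ⟨i, hi, fun j hj => he ▸ Nat.le_findGreatest (recurrenceRank_le j) ⟨j, hj, rfl⟩⟩
  refine exists_recurrence hf hmax (fun N => ?_) hk
  obtain ⟨t, ht, hrec⟩ := h (max N i)
  obtain ⟨-, rfl⟩ | ⟨-, -, hrec⟩ := hrec
  · omega
  · exact ⟨t, by omega, hrec i (by omega) hi⟩

/-- The order on codes of pairs: lexicographic, with the second component reversed. -/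
def RecordLE (n : ℕ) (f : ℕ → ℕ) (x y : ℕ) : Prop :=
  IsRecord n f x.unpair.1 x.unpair.2 ∧ IsRecord n f y.unpair.1 y.unpair.2 ∧
    (x.unpair.1 < y.unpair.1 ∨ x.unpair.1 = y.unpair.1 ∧ y.unpair.2 ≤ x.unpair.2)

theorem recordLE_congr {n : ℕ} {f g : ℕ → ℕ} {x y : ℕ} (h : ∀ i ≤ max x y, f i = g i) :
    RecordLE n f x y ↔ RecordLE n g x y := by
  have hx := Nat.unpair_right_le x
  have hy := Nat.unpair_right_le y
  unfold RecordLE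
  rw [isRecord_congr fun i hi => h i (by omega),
    isRecord_congr (b := y.unpair.1) (t := y.unpair.2) fun i hi => h i (by omega)]

/-- The linear order of records of a colouring. -/
def recordOrder (n : ℕ) (f : ℕ → ℕ) : CodedLinearOrder where
  le := RecordLE n f
  refl_left h := ⟨h.1, h.1, .inr ⟨rfl, le_rfl⟩⟩
  refl_right h := ⟨h.2.1, h.2.1, .inr ⟨rfl, le_rfl⟩⟩
  trans h h' := ⟨h.1, h'.2.1, by have := h.2.2; have := h'.2.2; omega⟩
  antisymm {a b} h h' := by
    have h1 : a.unpair.1 = b.unpair.1 := by have := h.2.2; have := h'.2.2; omega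
    have h2 : a.unpair.2 = b.unpair.2 := by have := h.2.2; have := h'.2.2; omega
    rw [← Nat.pair_unpair a, ← Nat.pair_unpair b, h1, h2]
  total {a b} h h' := by
    rcases (by omega : (a.unpair.1 < b.unpair.1 ∨ a.unpair.1 = b.unpair.1 ∧ b.unpair.2 ≤ a.unpair.2) ∨
      (b.unpair.1 < a.unpair.1 ∨ b.unpair.1 = a.unpair.1 ∧ a.unpair.2 ≤ b.unpair.2)) with h0 | h0
    · exact .inl ⟨h.1, h'.1, h0⟩
    · exact .inr ⟨h'.1, h.1, h0⟩

theorem recordOrder_lt_iff {n : ℕ} {f : ℕ → ℕ} (x y : (recordOrder n f).Elem) :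
    x < y ↔ x.val.unpair.1 < y.val.unpair.1 ∨
      x.val.unpair.1 = y.val.unpair.1 ∧ y.val.unpair.2 < x.val.unpair.2 := by
  have hle : y ≤ x ↔ _ := Iff.rfl (a := RecordLE n f y.val x.val)
  rw [← not_le, hle]
  unfold RecordLE
  have hx : IsRecord n f x.val.unpair.1 x.val.unpair.2 := x.mem.1
  have hy : IsRecord n f y.val.unpair.1 y.val.unpair.2 := y.mem.1
  simp only [hx, hy, true_and]
  omega

/-- A descending sequence of records yields a bound on the colours that do not recur. -/
theorem exists_recurrence_of_strictAnti {n : ℕ} {f : ℕ → ℕ} (hf : ∀ k, f k < n)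
    {y : ℕ → (recordOrder n f).Elem} (hy : StrictAnti y) {k : ℕ} (hk : (y 0).val.unpair.1 ≤ k) :
    ∃ l > k, f k = f l := by
  have hlt : ∀ {i j}, i < j → (y j).val.unpair.1 < (y i).val.unpair.1 ∨
      (y j).val.unpair.1 = (y i).val.unpair.1 ∧ (y i).val.unpair.2 < (y j).val.unpair.2 :=
    fun hij => (recordOrder_lt_iff _ _).1 (hy hij)
  have hanti : Antitone fun i => (y i).val.unpair.1 :=
    antitone_nat_of_succ_le fun i => by
      have := hlt (Nat.lt_add_one i)
      omega
  -- Once the first components are constant, the descent forces the second ones to increase.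
  obtain ⟨N, hN⟩ := WellFoundedLT.antitone_chain_condition (α := ℕ) hanti
  have hmono : StrictMono fun i => (y (N + i)).val.unpair.2 := fun i j hij => by
    have h1 := hN (N + i) (by omega)
    have h2 := hN (N + j) (by omega)
    have := hlt (show N + i < N + j by omega)
    simp only at h1 h2 ⊢
    omega
  refine exists_recurrence_of_isRecord hf (b := (y N).val.unpair.1) (fun M => ?_)
    ((hanti (Nat.zero_le N)).trans hk)
  refine ⟨_, (Nat.lt_succ_self M).trans_le (hmono.le_apply (x := M + 1)), ?_⟩
  rw [hN (N + (M + 1)) (by omega)]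
  exact (y (N + (M + 1))).mem.1

/-! ## The descending sequence of a colouring -/

/-- The last stage up to `k` of rank at least `j` (or `0`). -/
def lastOfRank (n : ℕ) (f : ℕ → ℕ) (j k : ℕ) : ℕ :=
  Nat.findGreatest (fun i => j ≤ recurrenceRank n f i) k

/-- The coefficient at the exponent `j` after stage `k`. -/
def recordCoeff (n : ℕ) (f : ℕ → ℕ) (j k : ℕ) : ℕ :=
  Nat.pair (lastOfRank n f (j + 1) k + 1) (lastOfRank n f j k)

section Sequence

variable {n : ℕ} {f g : ℕ → ℕ}

theorem lastOfRank_congr {j k : ℕ} (h : ∀ i ≤ k, f i = g i) :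
    lastOfRank n f j k = lastOfRank n g j k := by
  unfold lastOfRank
  induction k with
  | zero => rfl
  | succ k ih =>
    rw [Nat.findGreatest_succ, Nat.findGreatest_succ, ih fun i hi => h i (by omega),
      recurrenceRank_congr h]

theorem recordCoeff_congr {j k : ℕ} (h : ∀ i ≤ k, f i = g i) :
    recordCoeff n f j k = recordCoeff n g j k := by
  rw [recordCoeff, lastOfRank_congr h, lastOfRank_congr h, recordCoeff]

/-- Between the two stages all ranks are at most `j`, and the end stage has rank at least `j`. If
the two stages coincide the range is empty; this is the case `b = t + 1`. The default value `0` is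
harmless, as no stage precedes `0`. -/
theorem isRecord_lastOfRank (j k : ℕ) :
    IsRecord n f (lastOfRank n f (j + 1) k + 1) (lastOfRank n f j k) := by
  have hmono : lastOfRank n f (j + 1) k ≤ lastOfRank n f j k :=
    Nat.findGreatest_mono_left (fun i hi => (Nat.le_succ j).trans hi) k
  refine .inr ⟨by omega, by omega, fun i hi hji => ?_⟩
  have h1 : j ≤ recurrenceRank n f (lastOfRank n f j k) :=
    Nat.findGreatest_of_ne_zero (P := fun i => j ≤ recurrenceRank n f i) rfl (by omega)
  have h2 : ¬ j + 1 ≤ recurrenceRank n f i :=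
    Nat.findGreatest_is_greatest (P := fun i => j + 1 ≤ recurrenceRank n f i) hji
      (hi.le.trans (Nat.findGreatest_le k))
  omega

theorem lastOfRank_succ_of_lt {j k : ℕ} (h : recurrenceRank n f (k + 1) < j) :
    lastOfRank n f j (k + 1) = lastOfRank n f j k :=
  Nat.findGreatest_of_not (by omega)

theorem lastOfRank_succ_of_le {j k : ℕ} (h : j ≤ recurrenceRank n f (k + 1)) :
    lastOfRank n f j (k + 1) = k + 1 :=
  Nat.findGreatest_eq h

/-- The coefficient at the exponent `j` after stage `k`, as an element of the order. -/
def recordCoeffElem (n : ℕ) (f : ℕ → ℕ) (j k : ℕ) : (recordOrder n f).Elem where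
  val := recordCoeff n f j k
  mem := by
    have h : IsRecord n f (recordCoeff n f j k).unpair.1 (recordCoeff n f j k).unpair.2 := by
      rw [recordCoeff, Nat.unpair_pair]
      exact isRecord_lastOfRank j k
    exact ⟨h, h, .inr ⟨rfl, le_rfl⟩⟩

/-- The first component of a coefficient is a successor, so `(0, 0)` lies strictly below it. -/
theorem not_isBot_recordCoeffElem (j k : ℕ) : ¬ IsBot (recordCoeffElem n f j k) := by
  intro h
  have h0 : IsRecord n f (Nat.unpair 0).1 (Nat.unpair 0).2 := .inl (by simp)
  refine (h ⟨0, h0, h0, .inr ⟨rfl, le_rfl⟩⟩).not_gt ((recordOrder_lt_iff _ _).2 (.inl ?_))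
  simp [recordCoeffElem, recordCoeff]

/-- The `k`-th term of the descending sequence. -/
def recordTerm (n : ℕ) (f : ℕ → ℕ) (k : ℕ) : OmegaPow (recordOrder n f).Elem where
  val := (List.range (n + 1)).reverse.map fun j => toLex (j, recordCoeffElem n f j k)
  property := by
    constructor
    · rw [List.pairwise_map, List.pairwise_reverse]
      exact List.pairwise_lt_range
    · simp only [List.mem_map]
      rintro _ ⟨j, -, rfl⟩
      exact not_isBot_recordCoeffElem j k

theorem map_reverse_range_lt {α : Type*} [LinearOrder α] {a b : ℕ → α} {m r : ℕ} (hr : r ≤ m)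
    (heq : ∀ j > r, a j = b j) (hlt : a r < b r) :
    (List.range (m + 1)).reverse.map a < (List.range (m + 1)).reverse.map b := by
  induction m with
  | zero =>
    obtain rfl : r = 0 := by omega
    exact List.cons_lt_cons_iff.2 (.inl hlt)
  | succ m ih =>
    rw [List.range_succ, List.reverse_append, List.map_append, List.map_append]
    simp only [List.reverse_singleton, List.map_cons, List.map_nil, List.singleton_append]
    obtain rfl | hr := hr.eq_or_lt
    · exact List.cons_lt_cons_iff.2 (.inl hlt)
    · exact List.cons_lt_cons_iff.2 (.inr ⟨heq _ hr, ih (by omega)⟩)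

/-- The terms list the exponents downwards, so the comparison is decided at the rank of stage `k +
1`: there the first component stays and the second jumps to `k + 1`, which is smaller in the
reversed order. -/
theorem strictAnti_recordTerm : StrictAnti (recordTerm n f) := by
  refine strictAnti_nat_of_succ_lt fun k => ?_
  refine map_reverse_range_lt (recurrenceRank_le (n := n) (f := f) (k + 1)) (fun j hj => ?_) ?_
  · congr 2
    refine CodedLinearOrder.Elem.ext ?_
    simp only [recordCoeffElem, recordCoeff]
    rw [lastOfRank_succ_of_lt hj, lastOfRank_succ_of_lt (by omega)]
  · refine Prod.Lex.toLex_lt_toLex.2 (.inr ⟨rfl, (recordOrder_lt_iff _ _).2 (.inr ?_)⟩)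
    simp only [recordCoeffElem, recordCoeff, Nat.unpair_pair]
    rw [lastOfRank_succ_of_lt (Nat.lt_succ_self _), lastOfRank_succ_of_le le_rfl]
    exact ⟨rfl, Nat.lt_succ_of_le (Nat.findGreatest_le k)⟩

theorem encodeTerm_recordTerm (k : ℕ) : (recordOrder n f).encodeTerm (recordTerm n f k) =
    Encodable.encode ((List.range (n + 1)).reverse.map fun j => (j, recordCoeff n f j k)) := by
  simp only [CodedLinearOrder.encodeTerm, recordTerm, List.map_map]
  rfl

end Sequence

/-! ## Computability of the order and of the descending sequence -/

theorem PrimrecPred.forall_lt_comp {α : Type*} [Primcodable α] {u : α → ℕ} {R : ℕ → α → Prop}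
    (hu : Primrec u) (hR : PrimrecRel R) : PrimrecPred fun a => ∀ x < u a, R x a :=
  (hR.forall_mem_list.comp (Primrec.list_range.comp hu) Primrec.id).of_eq (by simp)

theorem PrimrecPred.exists_lt_comp {α : Type*} [Primcodable α] {u : α → ℕ} {R : ℕ → α → Prop}
    (hu : Primrec u) (hR : PrimrecRel R) : PrimrecPred fun a => ∃ x < u a, R x a :=
  (hR.exists_mem_list.comp (Primrec.list_range.comp hu) Primrec.id).of_eq (by simp)

theorem PrimrecPred.imp {α : Type*} [Primcodable α] {p q : α → Prop}
    (hp : PrimrecPred p) (hq : PrimrecPred q) : PrimrecPred fun a => p a → q a :=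
  (hp.not.or hq).of_eq fun _ => imp_iff_not_or.symm

section Primrec

open Primrec

variable {α : Type*} [Primcodable α] {n : α → ℕ} {f : α → ℕ → ℕ}

theorem primrec_recurrenceRank (hn : Primrec n) (hf : Primrec₂ f) :
    Primrec₂ fun a t => recurrenceRank (n a) (f a) t := by
  have hQ : PrimrecRel fun (c : ℕ) (q : α × ℕ) =>
      ∀ s < q.2, f q.1 s = f q.1 q.2 → ∃ u < q.2, s ≤ u ∧ f q.1 u = c := by
    refine PrimrecPred.forall_lt_comp (snd.comp snd) (PrimrecPred.imp ?_ ?_)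
    · exact Primrec.eq.comp (hf.comp (fst.comp (snd.comp snd)) fst)
        (hf.comp (fst.comp (snd.comp snd)) (snd.comp (snd.comp snd)))
    · refine PrimrecPred.exists_lt_comp (snd.comp (snd.comp snd)) (PrimrecPred.and ?_ ?_)
      · exact nat_le.comp (fst.comp snd) fst
      · exact Primrec.eq.comp (hf.comp (fst.comp (snd.comp (snd.comp snd))) fst)
          (fst.comp (snd.comp snd))
  exact list_length.comp (hQ.listFilter.comp (list_range.comp (hn.comp fst)) Primrec.id)

theorem primrecPred_isRecord (hn : Primrec n) (hf : Primrec₂ f) {b t : α → ℕ} (hb : Primrec b)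
    (ht : Primrec t) : PrimrecPred fun a => IsRecord (n a) (f a) (b a) (t a) := by
  have hr := primrec_recurrenceRank hn hf
  refine PrimrecPred.or ?_ (PrimrecPred.and ?_ (PrimrecPred.and ?_ ?_))
  · exact (Primrec.eq.comp hb (const 0)).and (Primrec.eq.comp ht (const 0))
  · exact nat_le.comp (const 1) hb
  · exact nat_le.comp hb (succ.comp ht)
  · refine PrimrecPred.forall_lt_comp ht (PrimrecPred.imp ?_ ?_)
    · exact nat_le.comp (hb.comp snd) fst
    · exact nat_le.comp (hr.comp snd fst) (hr.comp snd (ht.comp snd))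

theorem primrecPred_recordLE (hn : Primrec n) (hf : Primrec₂ f) {x y : α → ℕ} (hx : Primrec x)
    (hy : Primrec y) : PrimrecPred fun a => RecordLE (n a) (f a) (x a) (y a) := by
  have hx1 := fst.comp (unpair.comp hx)
  have hx2 := snd.comp (unpair.comp hx)
  have hy1 := fst.comp (unpair.comp hy)
  have hy2 := snd.comp (unpair.comp hy)
  exact (primrecPred_isRecord hn hf hx1 hx2).and ((primrecPred_isRecord hn hf hy1 hy2).and
    ((nat_lt.comp hx1 hy1).or ((Primrec.eq.comp hx1 hy1).and (nat_le.comp hy2 hx2))))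

theorem primrec_recordCoeff (hn : Primrec n) (hf : Primrec₂ f) :
    Primrec₂ fun a (q : ℕ × ℕ) => recordCoeff (n a) (f a) q.1 q.2 := by
  have hl : Primrec₂ fun a (q : ℕ × ℕ) => lastOfRank (n a) (f a) q.1 q.2 :=
    nat_findGreatest (snd.comp snd) (nat_le.comp (fst.comp (snd.comp fst))
      ((primrec_recurrenceRank hn hf).comp (fst.comp fst) snd))
  exact Primrec₂.natPair.comp
    (succ.comp (hl.comp fst (Primrec.pair (succ.comp (fst.comp snd)) (snd.comp snd)))) hl

end Primrec

open Classical in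
/-- The name of the instance of `WOPOmega` attached to the colouring `f` with `n` colours. -/
noncomputable def recordName (n : ℕ) (f : ℕ → ℕ) : ℕ → ℕ :=
  joinSeq (fun m => if RecordLE n f m.unpair.1 m.unpair.2 then 1 else 0)
    fun k => Encodable.encode ((List.range (n + 1)).reverse.map fun j => (j, recordCoeff n f j k))

theorem name_recordTerm (n : ℕ) (f : ℕ → ℕ) :
    Named.name (A := OmegaPowSeq) ⟨recordOrder n f, recordTerm n f⟩ = recordName n f := by
  simp only [Named.name, encodeTerm_recordTerm]
  rfl

/-- This locality is what lets a finite part of the oracle replace `f` in computing the name. -/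
theorem recordName_congr {n : ℕ} {f g : ℕ → ℕ} {m : ℕ} (h : ∀ i ≤ m, f i = g i) :
    recordName n f m = recordName n g m := by
  have h1 := Nat.unpair_left_le (m / 2)
  have h2 := Nat.unpair_right_le (m / 2)
  have h3 := Nat.div_le_self m 2
  have hc := fun j => recordCoeff_congr (n := n) (j := j) (k := m / 2) fun i hi => h i (by omega)
  simp only [recordName, joinSeq, hc]
  rw [recordLE_congr fun i hi => h i (by omega)]

theorem primrec_recordName {α : Type*} [Primcodable α] {n : α → ℕ} {f : α → ℕ → ℕ}
    (hn : Primrec n) (hf : Primrec₂ f) : Primrec₂ fun a m => recordName (n a) (f a) m := by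
  classical
  open Primrec in
  have hhalf : Primrec fun q : α × ℕ => q.2 / 2 := nat_div.comp snd (const 2)
  have hn' : Primrec fun q : α × ℕ => n q.1 := hn.comp fst
  have hf' : Primrec₂ fun (q : α × ℕ) i => f q.1 i := hf.comp (fst.comp fst) snd
  refine Primrec.ite (Primrec.eq.comp (nat_mod.comp snd (const 2)) (const 0))
    (Primrec.ite ?_ (const 1) (const 0)) (Primrec.encode.comp (list_map ?_ ?_))
  · exact primrecPred_recordLE hn' hf' (fst.comp (unpair.comp hhalf)) (snd.comp (unpair.comp hhalf))
  · exact list_reverse.comp (list_range.comp (succ.comp hn'))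
  · exact Primrec.pair snd ((primrec_recordCoeff hn' hf').comp fst
      (Primrec.pair snd (hhalf.comp fst)))

theorem isTuringFunctional_recordName :
    IsTuringFunctional fun p => recordName (p 0) fun i => p (2 * i + 1) := by
  have hn : Primrec fun l : List ℕ => l.getD 0 0 := (Primrec.list_getD 0).comp .id (.const 0)
  have hf : Primrec₂ fun (l : List ℕ) i => l.getD (2 * i + 1) 0 :=
    (Primrec.list_getD 0).comp .fst (Primrec.nat_double_succ.comp .snd)
  -- In the name of `(n, f)`, position `0` holds `n` and position `2 * i + 1` holds `f i`; length `2
  -- * m + 2` covers all `i ≤ m`.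
  have h := IsTuringFunctional.of_primrec_initialSegment (primrec_recordName hn hf)
    (u := fun m => 2 * m + 2) (Primrec.succ.comp Primrec.nat_double_succ)
  convert h using 3 with p m
  rw [show ((List.range (2 * m + 2)).map p).getD 0 0 = p 0 by simp [List.getD]]
  refine recordName_congr fun i hi => ?_
  have : 2 * i + 1 < 2 * m + 2 := by omega
  simp [List.getD, this]

theorem mainTheorem5 : ECT ≤_W WOPOmega := by
  obtain ⟨H, hH⟩ := isTuringFunctional_recordName
  -- Position `1` of the join is the first entry of the solution.
  obtain ⟨K, hK⟩ : IsTuringFunctional fun p _ => (p 1).unpair.1 :=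
    (IsTuringFunctional.of_primrec .left).comp
      (IsTuringFunctional.oracle.comp (.of_primrec (Nat.Primrec.const 1)))
  refine ⟨H, K, ?_⟩
  rintro ⟨n, f⟩ hf
  refine ⟨⟨recordOrder n f, recordTerm n f⟩, strictAnti_recordTerm, ?_, ?_⟩
  · have hf' : (fun i => Named.name (n, f) (2 * i + 1)) = f := by
      funext i
      have h1 : (2 * i + 1) % 2 = 1 := by omega
      have h2 : (2 * i + 1) / 2 = i := by omega
      simp [Named.name, joinSeq, h1, h2]
    rw [name_recordTerm, show recordName n f = recordName n fun i => Named.name (n, f) (2 * i + 1)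
      from congrArg _ hf'.symm]
    exact hH (Named.name (n, f))
  · rintro τ ⟨y, hy, -, hτ⟩
    refine ⟨(τ 0).unpair.1, fun k hk => ?_, hK _⟩
    rw [hτ 0] at hk
    exact exists_recurrence_of_strictAnti hf hy (Nat.le_of_lt hk)
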